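/- Let $d\ge 1$ be an integer and $\Omega=[-1,1]^d$. Functions on $\Omega$ that are periodic are identified with their extensions to $\mathbb R^d$ that are $2$-periodic in each coordinate, and for such functions $f*g(x)=\int_\Omega f(y)\,g(x-y)\,dy$. For $n\in\mathbb Z$ and $t\in\mathbb R$ let $\mathrm{soc}(0,t)=1$, $\mathrm{soc}(n,t)=\sin(n\pi t)$ if $n>0$, and $\mathrm{soc}(n,t)=\cos(n\pi t)$ if $n<0$. For an integer $N\ge 1$, a trigonometric polynomial of degree at most $N$ is a function of the form $$f(z)=\sum_{\boldsymbol n\in\mathbb Z^d,\ \|\boldsymbol n\|_1\le N}\theta_{\boldsymbol n}\prod_{i=1}^d\mathrm{soc}(n_i,z_i),\qquad \theta_{\boldsymbol n}\in\mathbb R .$$ For an integer $n\ge 0$ let $$D_n^0(z)=2^{-d}\sum_{\boldsymbol k\in\mathbb Z^d,\ \|\boldsymbol k\|_1\le n}e^{i\pi\,\boldsymbol k\cdot z}$$ be the (real-valued) Dirichlet kernel of order $n$, normalized by the volume $2^d$ of $\Omega$, and for every positive even integer $N$ let $$D_N=\frac1{N/2+1}\sum_{n=N/2}^{N}D_n^0$$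 be the de la Vallée-Poussin kernel. Then the following hold. 1. For every positive even integer $N$ and every periodic function $f:\Omega\to\mathbb R$ that is integrable on $\Omega$, $D_N*f$ is a trigonometric polynomial of degree at most $N$. 2. For every positive even integer $N$ and every trigonometric polynomial $f$ of degree at most $N/2$, $D_N*f=f$. 3. There is a finite constant $\Lambda_d$, depending only on $d$, such that $\|D_N\|_{L^1(\Omega)}\le\Lambda_d$ for every positive even integer $N$. -/

import Mathlib

open MeasureTheory

namespace ValleePoussin

/-- The fundamental domain `Ω = [-1, 1]^d`. -/
def cube (d : ℕ) : Set (Fin d → ℝ) := Set.Icc (fun _ => -1) (fun _ => 1)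

/-- Periodic functions on `[-1, 1]^d`, identified with their extensions to `ℝ^d` that have
period `2` in each coordinate. -/
def IsPeriodic {d : ℕ} (f : (Fin d → ℝ) → ℝ) : Prop :=
  ∀ i : Fin d, Function.Periodic f (Pi.single i 2)

/-- The multi-indices `n ∈ ℤ^d` with `‖n‖₁ = |n₁| + ⋯ + |n_d| ≤ N`. -/
noncomputable def multiIndices (d N : ℕ) : Finset (Fin d → ℤ) :=
  (Fintype.piFinset fun _ => Finset.Icc (-(N : ℤ)) (N : ℤ)).filter
    fun n => ∑ i, |n i| ≤ (N : ℤ)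

/-- The box in the definition of `multiIndices` excludes nothing. -/
theorem mem_multiIndices {d N : ℕ} {n : Fin d → ℤ} :
    n ∈ multiIndices d N ↔ ∑ i, |n i| ≤ (N : ℤ) := by
  unfold multiIndices
  rw [Finset.mem_filter, Fintype.mem_piFinset]
  refine ⟨fun h => h.2, fun h => ⟨fun i => ?_, h⟩⟩
  have h1 : |n i| ≤ ∑ j, |n j| :=
    Finset.single_le_sum (f := fun j => |n j|) (fun j _ => abs_nonneg _) (Finset.mem_univ i)
  exact Finset.mem_Icc.2 (abs_le.1 (h1.trans h))

/-- The univariate functions `1`, `sin (n π t)` for `n > 0`, `cos (n π t)` for `n < 0`. -/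
noncomputable def soc (n : ℤ) (t : ℝ) : ℝ :=
  if n = 0 then 1
  else if 0 < n then Real.sin (n * Real.pi * t)
  else Real.cos (n * Real.pi * t)

/-- The multivariate trigonometric monomials. -/
noncomputable def socMonomial {d : ℕ} (n : Fin d → ℤ) (z : Fin d → ℝ) : ℝ :=
  ∏ i, soc (n i) (z i)

/-- Real trigonometric polynomials in `d` variables of (total) degree at most `N`. -/
def trigPoly (d N : ℕ) : Set ((Fin d → ℝ) → ℝ) :=
  {f | ∃ θ : (Fin d → ℤ) → ℝ, ∀ z, f z = ∑ n ∈ multiIndices d N, θ n * socMonomial n z}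

/-- Circular convolution on `[-1, 1]^d`. -/
noncomputable def circConv {d : ℕ} (f g : (Fin d → ℝ) → ℝ) (x : Fin d → ℝ) : ℝ :=
  ∫ y in cube d, f y * g (x - y)

/-- The Dirichlet kernel of order `n`, in real form. The factor `2⁻ᵈ` is the inverse of the
volume of `[-1, 1]^d`: with it, convolution with the kernel truncates Fourier series at
`‖k‖₁ ≤ n`. -/
noncomputable def dirichletKernel (d n : ℕ) (z : Fin d → ℝ) : ℝ :=
  (2 ^ d)⁻¹ * ∑ k ∈ multiIndices d n, Real.cos (Real.pi * ∑ i, (k i : ℝ) * z i)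

/-- The usual complex form of the Dirichlet kernel. -/
theorem dirichletKernel_eq_exp (d n : ℕ) (z : Fin d → ℝ) :
    (dirichletKernel d n z : ℂ) = (2 ^ d)⁻¹ * ∑ k ∈ multiIndices d n,
      Complex.exp (Complex.I * Real.pi * ∑ i, (k i : ℂ) * z i) := by
  have hneg : ∑ k ∈ multiIndices d n, Complex.exp (Complex.I * Real.pi * ∑ i, (k i : ℂ) * z i)
      = ∑ k ∈ multiIndices d n, Complex.exp (-(Complex.I * Real.pi * ∑ i, (k i : ℂ) * z i)) := by
    refine Finset.sum_bij (fun k _ => -k) ?_ ?_ ?_ ?_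
    · intro k hk
      simpa [mem_multiIndices] using hk
    · intro a _ b _ h
      simpa using h
    · intro b hb
      exact ⟨-b, by simpa [mem_multiIndices] using hb, neg_neg b⟩
    · intro k _
      simp
  have hcos : ∑ k ∈ multiIndices d n, Complex.cos (Real.pi * ∑ i, (k i : ℂ) * z i)
      = ∑ k ∈ multiIndices d n, Complex.exp (Complex.I * Real.pi * ∑ i, (k i : ℂ) * z i) := by
    have h2 : ∀ k : Fin d → ℤ, Complex.cos (Real.pi * ∑ i, (k i : ℂ) * z i)
        = (Complex.exp (Complex.I * Real.pi * ∑ i, (k i : ℂ) * z i)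
          + Complex.exp (-(Complex.I * Real.pi * ∑ i, (k i : ℂ) * z i))) / 2 := by
      intro k
      rw [Complex.cos]
      ring_nf
    rw [Finset.sum_congr rfl fun k _ => h2 k, ← Finset.sum_div, Finset.sum_add_distrib, ← hneg]
    ring
  rw [← hcos]
  simp [dirichletKernel]

/-- The de la Vallée-Poussin kernel `D_N`, for even `N`: the average of the Dirichlet kernels
of orders `N/2, …, N`. -/
noncomputable def kernel (d N : ℕ) (z : Fin d → ℝ) : ℝ :=
  (((N / 2 : ℕ) : ℝ) + 1)⁻¹ * ∑ n ∈ Finset.Icc (N / 2) N, dirichletKernel d n z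

end ValleePoussin

namespace ValleePoussin

/-! ### Translation invariance of integrals over a period -/

/-! Claims 1 and 2 are Fourier analysis. Since characters satisfy `expMonomial_sub`, convolving with
the kernel retains only frequencies of degree at most `N`. Every Dirichlet kernel in the average has
order at least `N/2`, so frequencies of degree at most `N/2` are fixed. Characters and real
monomials convert into each other by mixing only the indices `n i` and `-n i`, which preserves the
degree.

Claim 3 reduces to `integral_norm_sum_dirichletKernel_le`: the sum of the first `n` Dirichlet
kernels has `L¹` norm `O(n)`. The constraint on the `ℓ¹` norm of `k` does not factor over the
coordinates, but `w ^ ‖k‖₁` does, so `∏ i, poissonSum K w (z i)` is a generating function for it.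
Integrating against `fejerWeight` over the circle `‖w‖ = r` recovers the sum
(`sum_dirichletKernel_eq_integral`), and Fubini leaves the weight times the `d`-th power of a
univariate norm.

With `r = 1 - 1/(n+1)` the weight is at most `8 / ‖1-w‖^2`, and the univariate norm is at most a
constant times `(‖1-w‖/(1-r))^p` for any `0 < p ≤ 1` (`integral_norm_poissonSum_le`). Taking `p =
1/(2d)` leaves `(1-r)^(-1/2) * ‖1-w‖^(-3/2)`, whose integral over the circle is `O(1/(1-r)) =
O(n+1)` by `circleMoment_le`. -/

theorem IsPeriodic.add_intCast_mul_two {d : ℕ} {f : (Fin d → ℝ) → ℝ} (hf : IsPeriodic f)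
    (m : Fin d → ℤ) (x : Fin d → ℝ) : f (fun i => x i + m i * 2) = f x := by
  have key : ∀ s : Finset (Fin d), f (x + ∑ i ∈ s, m i • Pi.single i (2 : ℝ)) = f x := by
    intro s
    induction s using Finset.induction_on with
    | empty => simp
    | insert a s ha ih =>
      rw [Finset.sum_insert ha, add_comm (m a • _), ← add_assoc]
      exact ((hf a).zsmul (m a) _).trans ih
  rw [← key Finset.univ]
  congr 1
  ext i
  simp [Finset.sum_apply, Pi.single_apply]

/-- The lattice `(2ℤ)^d` of periods. -/
noncomputable def periodHom (d : ℕ) : (Fin d → ℤ) →+ (Fin d → ℝ) :=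
  AddMonoidHom.mk' (fun m i => (m i : ℝ) * 2) fun a b => by
    ext i
    simp [add_mul]

instance countable_range_periodHom (d : ℕ) : Countable (periodHom d).range :=
  (Set.countable_range (periodHom d)).to_subtype

theorem periodHom_vadd_apply {d : ℕ} (m : Fin d → ℤ) (x : Fin d → ℝ) (i : Fin d) :
    ((⟨periodHom d m, m, rfl⟩ : (periodHom d).range) +ᵥ x) i = x i + m i * 2 :=
  add_comm _ _

/-- Half-open sides make each orbit meet the box exactly once, coordinate by coordinate. -/
theorem isAddFundamentalDomain_pi_Ioc {d : ℕ} (c : Fin d → ℝ) :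
    IsAddFundamentalDomain (periodHom d).range
      (Set.univ.pi fun i => Set.Ioc (c i) (c i + 2)) volume := by
  refine IsAddFundamentalDomain.mk'
    (MeasurableSet.univ_pi fun i => measurableSet_Ioc).nullMeasurableSet fun x => ?_
  have h := fun i => existsUnique_add_zsmul_mem_Ioc (zero_lt_two' ℝ) (x i) (c i)
  choose m hm hu using h
  refine ⟨⟨periodHom d m, m, rfl⟩, ?_, ?_⟩
  · intro i _
    simpa only [periodHom_vadd_apply, zsmul_eq_mul] using hm i
  · rintro ⟨_, k, rfl⟩ hk
    have : k = m := by
      ext i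
      refine hu i (k i) ?_
      have := hk i (Set.mem_univ i)
      simpa only [periodHom_vadd_apply, zsmul_eq_mul] using this
    rw [this]

/-- The map `y ↦ x - y` carries the cube to its translate centred at `x`. Up to null sets both are
fundamental domains of the same lattice, so an invariant function has the same integral over them.
-/
theorem IsPeriodic.setIntegral_cube_sub {d : ℕ} {f : (Fin d → ℝ) → ℝ} (hf : IsPeriodic f)
    (x : Fin d → ℝ) : ∫ y in cube d, f (x - y) = ∫ y in cube d, f y := by
  have hIcc : ∀ c : Fin d → ℝ, ∫ y in Set.Icc c (fun i => c i + 2), f y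
      = ∫ y in Set.univ.pi fun i => Set.Ioc (c i) (c i + 2), f y := fun c =>
    setIntegral_congr_set (Measure.univ_pi_Ioc_ae_eq_Icc (f := c)).symm
  have hinv : ∀ (g : (periodHom d).range) (y : Fin d → ℝ), f (g +ᵥ y) = f y := by
    rintro ⟨_, m, rfl⟩ y
    rw [← hf.add_intCast_mul_two m y]
    congr 1
    ext i
    exact periodHom_vadd_apply m y i
  have hpre : cube d = (fun y => x - y) ⁻¹' Set.Icc (fun i => x i - 1) (fun i => x i - 1 + 2) := by
    ext y
    simp only [cube, Set.mem_preimage, Set.mem_Icc, Pi.le_def, Pi.sub_apply]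
    refine ⟨fun h => ⟨fun i => ?_, fun i => ?_⟩, fun h => ⟨fun i => ?_, fun i => ?_⟩⟩ <;>
      linarith [h.1 i, h.2 i]
  have hcube : cube d = Set.Icc (fun _ => -1) (fun _ => -1 + 2) := by
    rw [cube]
    norm_num
  conv_lhs => rw [hpre]
  rw [(Measure.measurePreserving_sub_left volume x).setIntegral_preimage_emb
      (Homeomorph.subLeft x).measurableEmbedding, hIcc, hcube, hIcc]
  exact (isAddFundamentalDomain_pi_Ioc _).setIntegral_eq (isAddFundamentalDomain_pi_Ioc _) hinv

theorem circConv_comm {d : ℕ} {f g : (Fin d → ℝ) → ℝ} (hf : IsPeriodic f) (hg : IsPeriodic g) :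
    circConv f g = circConv g f := by
  ext x
  have hp : IsPeriodic fun y => g y * f (x - y) := by
    intro i y
    have h1 := hg i y
    have h2 := (hf i).neg (x - y)
    rw [show x - y + -Pi.single i 2 = x - (y + Pi.single i 2) by abel] at h2
    simp only [h1, h2]
  rw [circConv, circConv, ← hp.setIntegral_cube_sub x]
  refine integral_congr_ae (Filter.Eventually.of_forall fun y => ?_)
  simp [mul_comm]

/-! ### Exponentials and trigonometric monomials -/

/-- The character `t ↦ exp (iπkt)`. -/
noncomputable def expi (k : ℤ) (t : ℝ) : ℂ := Complex.exp (Complex.I * Real.pi * (k * t))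

/-- The multivariate character `z ↦ exp (iπ k ⬝ z)`. -/
noncomputable def expMonomial {d : ℕ} (k : Fin d → ℤ) (z : Fin d → ℝ) : ℂ :=
  ∏ i, expi (k i) (z i)

theorem expi_eq (k : ℤ) (t : ℝ) :
    expi k t = Real.cos (k * Real.pi * t) + Real.sin (k * Real.pi * t) * Complex.I := by
  rw [expi, Complex.ofReal_cos, Complex.ofReal_sin, ← Complex.exp_mul_I]
  push_cast
  ring_nf

theorem continuous_expi (k : ℤ) : Continuous (expi k) := by
  unfold expi
  fun_prop

theorem continuous_expMonomial {d : ℕ} (k : Fin d → ℤ) :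
    Continuous (expMonomial k : (Fin d → ℝ) → ℂ) :=
  continuous_finsetProd _ fun i _ => (continuous_expi _).comp (continuous_apply i)

theorem expMonomial_eq_exp {d : ℕ} (k : Fin d → ℤ) (z : Fin d → ℝ) :
    expMonomial k z = Complex.exp (Complex.I * Real.pi * ∑ i, (k i : ℂ) * z i) := by
  simp only [expMonomial, expi]
  rw [← Complex.exp_sum, Finset.mul_sum]

theorem expi_sub (k : ℤ) (s t : ℝ) : expi k (s - t) = expi k s * expi (-k) t := by
  simp only [expi]
  rw [← Complex.exp_add]
  push_cast
  ring_nf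

theorem expMonomial_sub {d : ℕ} (k : Fin d → ℤ) (x y : Fin d → ℝ) :
    expMonomial k (x - y) = expMonomial k x * expMonomial (-k) y := by
  simp [expMonomial, expi_sub, Finset.prod_mul_distrib]

theorem dirichletKernel_eq_expMonomial (d n : ℕ) (z : Fin d → ℝ) :
    (dirichletKernel d n z : ℂ) = (2 ^ d)⁻¹ * ∑ k ∈ multiIndices d n, expMonomial k z := by
  simp only [dirichletKernel_eq_exp, expMonomial_eq_exp]

/-- Univariate changes of basis which only mix the indices `k` and `-k` tensorize to
multivariate ones that preserve the degree. -/
theorem prod_eq_sum_multiIndices {d N : ℕ} {A B : ℤ → ℝ → ℂ}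
    (h : ∀ k, ∃ c : ℤ → ℂ, ∀ t, A k t = ∑ n ∈ {k, -k}, c n * B n t)
    {k : Fin d → ℤ} (hk : k ∈ multiIndices d N) :
    ∃ θ : (Fin d → ℤ) → ℂ, ∀ z : Fin d → ℝ,
      ∏ i, A (k i) (z i) = ∑ n ∈ multiIndices d N, θ n * ∏ i, B (n i) (z i) := by
  choose c hc using h
  -- `S` is the set of sign changes of `k`, all of the same `ℓ¹` norm. For `k i = 0` the set `{k i,
  -- -k i}` is a singleton, so no term is counted twice.
  let S : Finset (Fin d → ℤ) := Fintype.piFinset fun i => {k i, -k i}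
  have hS : S ⊆ multiIndices d N := by
    intro n hn
    rw [mem_multiIndices] at hk ⊢
    refine (Finset.sum_congr rfl fun i _ => ?_).trans_le hk
    have := Fintype.mem_piFinset.1 hn i
    rw [Finset.mem_insert, Finset.mem_singleton] at this
    rcases this with h | h <;> simp [h]
  refine ⟨fun n => if n ∈ S then ∏ i, c (k i) (n i) else 0, fun z => ?_⟩
  simp only [hc, Finset.prod_univ_sum, Finset.prod_mul_distrib]
  rw [← Finset.sum_subset hS]
  · refine Finset.sum_congr rfl fun n hn => ?_
    rw [if_pos hn]
  · intro n _ hn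
    rw [if_neg hn, zero_mul]

/-- Negative indices carry the cosine and positive ones the sine, so Euler's formula uses both `k`
and `-k`, with a coefficient depending only on the sign of the index. -/
theorem expi_eq_sum_soc (k : ℤ) :
    ∃ c : ℤ → ℂ, ∀ t, expi k t = ∑ n ∈ {k, -k}, c n * (soc n t : ℂ) := by
  rcases lt_trichotomy k 0 with h | h | h
  · refine ⟨fun n => if n < 0 then 1 else -Complex.I, fun t => ?_⟩
    rw [Finset.sum_pair (by omega)]
    have h1 : ¬ k = 0 := by omega
    have h2 : ¬ 0 < k := by omega
    simp only [soc, expi_eq, h, h1, h2, if_true, if_false, neg_eq_zero, Left.neg_pos_iff,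
      show ¬ -k < 0 by omega]
    push_cast
    rw [show -(k : ℂ) * Real.pi * t = -(k * Real.pi * t) by ring, Complex.sin_neg]
    ring
  · subst h
    exact ⟨fun _ => 1, fun t => by simp [soc, expi]⟩
  · refine ⟨fun n => if n < 0 then 1 else Complex.I, fun t => ?_⟩
    rw [Finset.sum_pair (by omega)]
    have h1 : ¬ k = 0 := by omega
    simp only [soc, expi_eq, h, h1, if_true, if_false, neg_eq_zero, Left.neg_pos_iff,
      show ¬ k < 0 by omega, show -k < 0 by omega]
    push_cast
    rw [show -(k : ℂ) * Real.pi * t = -(k * Real.pi * t) by ring, Complex.cos_neg]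
    ring

theorem soc_eq_sum_expi (n : ℤ) :
    ∃ c : ℤ → ℂ, ∀ t, (soc n t : ℂ) = ∑ k ∈ {n, -n}, c k * expi k t := by
  rcases lt_trichotomy n 0 with h | h | h
  · refine ⟨fun _ => 1 / 2, fun t => ?_⟩
    rw [Finset.sum_pair (by omega)]
    have h1 : ¬ n = 0 := by omega
    have h2 : ¬ 0 < n := by omega
    simp only [soc, expi_eq, h1, h2, if_false]
    push_cast
    rw [show -(n : ℂ) * Real.pi * t = -(n * Real.pi * t) by ring, Complex.sin_neg,
      Complex.cos_neg]
    ring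
  · subst h
    exact ⟨fun _ => 1, fun t => by simp [soc, expi]⟩
  · refine ⟨fun k => if 0 < k then -Complex.I / 2 else Complex.I / 2, fun t => ?_⟩
    rw [Finset.sum_pair (by omega)]
    have h1 : ¬ n = 0 := by omega
    simp only [soc, expi_eq, h, h1, if_true, if_false, show ¬ 0 < -n by omega]
    push_cast
    rw [show -(n : ℂ) * Real.pi * t = -(n * Real.pi * t) by ring, Complex.sin_neg,
      Complex.cos_neg]
    ring_nf
    rw [Complex.I_sq]
    ring

theorem expMonomial_eq_sum_socMonomial {d N : ℕ} {k : Fin d → ℤ} (hk : k ∈ multiIndices d N) :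
    ∃ θ : (Fin d → ℤ) → ℂ, ∀ z : Fin d → ℝ,
      expMonomial k z = ∑ n ∈ multiIndices d N, θ n * (socMonomial n z : ℂ) := by
  simpa [expMonomial, socMonomial] using
    prod_eq_sum_multiIndices (B := fun n t => (soc n t : ℂ)) expi_eq_sum_soc hk

theorem socMonomial_eq_sum_expMonomial {d N : ℕ} {n : Fin d → ℤ} (hn : n ∈ multiIndices d N) :
    ∃ c : (Fin d → ℤ) → ℂ, ∀ z : Fin d → ℝ,
      (socMonomial n z : ℂ) = ∑ k ∈ multiIndices d N, c k * expMonomial k z := by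
  simpa [expMonomial, socMonomial] using
    prod_eq_sum_multiIndices (A := fun n t => (soc n t : ℂ)) soc_eq_sum_expi hn

theorem trigPoly.add_mem {d N : ℕ} {f g : (Fin d → ℝ) → ℝ} (hf : f ∈ trigPoly d N)
    (hg : g ∈ trigPoly d N) : f + g ∈ trigPoly d N := by
  obtain ⟨a, ha⟩ := hf
  obtain ⟨b, hb⟩ := hg
  exact ⟨a + b, fun z => by simp [ha, hb, add_mul, Finset.sum_add_distrib]⟩

theorem trigPoly.sum_mem {d N : ℕ} {ι : Type*} (s : Finset ι) {f : ι → (Fin d → ℝ) → ℝ}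
    (hf : ∀ i ∈ s, f i ∈ trigPoly d N) : (fun z => ∑ i ∈ s, f i z) ∈ trigPoly d N := by
  classical
  induction s using Finset.induction_on with
  | empty => exact ⟨0, fun z => by simp⟩
  | insert a s ha ih =>
    simp only [Finset.sum_insert ha]
    exact trigPoly.add_mem (hf a (Finset.mem_insert_self a s))
      (ih fun i hi => hf i (Finset.mem_insert_of_mem hi))

/-- The real part turns the complex coefficients into the real ones that `trigPoly` requires. -/
theorem re_mul_expMonomial_mem_trigPoly {d N : ℕ} {k : Fin d → ℤ} (hk : k ∈ multiIndices d N)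
    (c : ℂ) : (fun z => (c * expMonomial k z).re) ∈ trigPoly d N := by
  obtain ⟨θ, hθ⟩ := expMonomial_eq_sum_socMonomial hk
  refine ⟨fun n => (c * θ n).re, fun z => ?_⟩
  change (c * expMonomial k z).re = _
  rw [hθ, Finset.mul_sum, Complex.re_sum]
  refine Finset.sum_congr rfl fun n _ => ?_
  rw [← mul_assoc, Complex.re_mul_ofReal]

theorem exists_coeff_of_mem_trigPoly {d N : ℕ} {f : (Fin d → ℝ) → ℝ} (hf : f ∈ trigPoly d N) :
    ∃ c : (Fin d → ℤ) → ℂ, ∀ z, (f z : ℂ) = ∑ k ∈ multiIndices d N, c k * expMonomial k z := by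
  obtain ⟨θ, hθ⟩ := hf
  have h : ∀ n : Fin d → ℤ, ∃ c : (Fin d → ℤ) → ℂ, n ∈ multiIndices d N → ∀ z : Fin d → ℝ,
      (socMonomial n z : ℂ) = ∑ k ∈ multiIndices d N, c k * expMonomial k z := by
    intro n
    by_cases hn : n ∈ multiIndices d N
    · obtain ⟨c, hc⟩ := socMonomial_eq_sum_expMonomial hn
      exact ⟨c, fun _ => hc⟩
    · exact ⟨0, fun h => absurd h hn⟩
  choose c hc using h
  refine ⟨fun k => ∑ n ∈ multiIndices d N, θ n * c n k, fun z => ?_⟩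
  rw [hθ]
  push_cast
  simp only [Finset.sum_mul]
  rw [Finset.sum_comm]
  refine Finset.sum_congr rfl fun n hn => ?_
  rw [hc n hn, Finset.mul_sum]
  exact Finset.sum_congr rfl fun k _ => (mul_assoc _ _ _).symm

/-! ### Orthogonality -/

theorem volume_restrict_cube (d : ℕ) : (volume : Measure (Fin d → ℝ)).restrict (cube d)
    = Measure.pi fun _ => (volume : Measure ℝ).restrict (Set.Icc (-1) 1) := by
  rw [cube, ← Set.pi_univ_Icc, volume_pi, Measure.restrict_pi_pi]

theorem setIntegral_Icc_neg_one_one {E : Type*} [NormedAddCommGroup E] [NormedSpace ℝ E]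
    (f : ℝ → E) : ∫ t in Set.Icc (-1 : ℝ) 1, f t = ∫ t in (-1 : ℝ)..1, f t := by
  rw [intervalIntegral.integral_of_le (by norm_num), integral_Icc_eq_integral_Ioc]

theorem integral_expi (k : ℤ) : ∫ t in (-1 : ℝ)..1, expi k t = if k = 0 then 2 else 0 := by
  split_ifs with hk
  · subst hk
    simp [expi]
    norm_num
  · have hc : Complex.I * Real.pi * k ≠ 0 := by
      simp [hk, Real.pi_ne_zero]
    simp only [expi, ← mul_assoc]
    rw [integral_exp_mul_complex hc, div_eq_zero_iff]
    left
    rw [sub_eq_zero, Complex.exp_eq_exp_iff_exists_int]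
    exact ⟨k, by push_cast; ring⟩

theorem integral_expMonomial {d : ℕ} (k : Fin d → ℤ) :
    ∫ z in cube d, expMonomial k z = if k = 0 then 2 ^ d else 0 := by
  rw [volume_restrict_cube]
  simp only [expMonomial]
  rw [integral_fintype_prod_eq_prod]
  simp only [setIntegral_Icc_neg_one_one, integral_expi]
  split_ifs with hk
  · simp [hk]
  · obtain ⟨i, hi⟩ := Function.ne_iff.1 hk
    exact Finset.prod_eq_zero (Finset.mem_univ i) (if_neg hi)

theorem isCompact_cube (d : ℕ) : IsCompact (cube d) := isCompact_Icc

theorem continuous_dirichletKernel (d n : ℕ) : Continuous (dirichletKernel d n) := by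
  unfold dirichletKernel
  fun_prop

theorem continuous_kernel (d n : ℕ) : Continuous (kernel d n) := by
  unfold kernel
  exact continuous_const.mul (continuous_finsetSum _ fun _ _ => continuous_dirichletKernel _ _)

theorem expMonomial_mul {d : ℕ} (k l : Fin d → ℤ) (z : Fin d → ℝ) :
    expMonomial k z * expMonomial l z = expMonomial (k + l) z := by
  simp only [expMonomial_eq_exp]
  rw [← Complex.exp_add, ← mul_add, ← Finset.sum_add_distrib]
  simp [add_mul]

theorem integral_dirichletKernel_mul_expMonomial {d n : ℕ} {k : Fin d → ℤ}
    (hk : k ∈ multiIndices d n) :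
    ∫ z in cube d, (dirichletKernel d n z : ℂ) * expMonomial (-k) z = 1 := by
  simp only [dirichletKernel_eq_expMonomial, mul_assoc, Finset.sum_mul, expMonomial_mul]
  rw [integral_const_mul, integral_finsetSum]
  · simp only [integral_expMonomial, add_neg_eq_zero]
    rw [Finset.sum_ite_eq' _ k, if_pos hk]
    exact inv_mul_cancel₀ (pow_ne_zero _ two_ne_zero)
  · intro l _
    exact (continuous_expMonomial _).continuousOn.integrableOn_compact (isCompact_cube d)

theorem multiIndices_mono {d m n : ℕ} (h : m ≤ n) : multiIndices d m ⊆ multiIndices d n := by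
  intro k hk
  rw [mem_multiIndices] at hk ⊢
  exact hk.trans (by exact_mod_cast h)

theorem integral_kernel_mul_expMonomial {d N : ℕ} (hN : Even N) {k : Fin d → ℤ}
    (hk : k ∈ multiIndices d (N / 2)) :
    ∫ z in cube d, (kernel d N z : ℂ) * expMonomial (-k) z = 1 := by
  simp only [kernel, Complex.ofReal_mul, Complex.ofReal_sum, mul_assoc, Finset.sum_mul]
  rw [integral_const_mul, integral_finsetSum]
  · rw [Finset.sum_congr rfl fun n hn => integral_dirichletKernel_mul_expMonomial
      (multiIndices_mono (Finset.mem_Icc.1 hn).1 hk)]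
    -- Evenness makes the number of averaged orders equal to the normalizing factor `N/2 + 1`.
    obtain ⟨m, rfl⟩ := hN
    have h2 : (m + m) / 2 = m := by omega
    have h3 : m + m + 1 - m = m + 1 := by omega
    rw [h2, Finset.sum_const, Nat.card_Icc, h3]
    push_cast
    rw [nsmul_one]
    push_cast
    exact inv_mul_cancel₀ (by exact_mod_cast Nat.succ_ne_zero m)
  · intro n _
    exact ((Complex.continuous_ofReal.comp (continuous_dirichletKernel d n)).mul
      (continuous_expMonomial _)).continuousOn.integrableOn_compact (isCompact_cube d)

/-! ### Range of the convolution and reproduction of polynomials. -/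

theorem dirichletKernel_isPeriodic (d n : ℕ) : IsPeriodic (dirichletKernel d n) := by
  intro i z
  simp only [dirichletKernel]
  congr 1
  refine Finset.sum_congr rfl fun k _ => ?_
  have : Real.pi * ∑ j, (k j : ℝ) * (z + Pi.single i 2 : Fin d → ℝ) j
      = Real.pi * ∑ j, (k j : ℝ) * z j + k i * (2 * Real.pi) := by
    simp [mul_add, Finset.sum_add_distrib, Pi.single_apply]
    ring
  rw [this, Real.cos_add_int_mul_two_pi]

theorem kernel_isPeriodic (d N : ℕ) : IsPeriodic (kernel d N) := by
  intro i z
  simp only [kernel, dirichletKernel_isPeriodic d _ i z]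

theorem circConv_kernel_mem_trigPoly {d N : ℕ} {f : (Fin d → ℝ) → ℝ} (hf : IsPeriodic f)
    (hint : IntegrableOn f (cube d)) : circConv (kernel d N) f ∈ trigPoly d N := by
  -- With the shift on the kernel, `x` enters only through characters, and the coefficients are
  -- Fourier coefficients of `f`.
  rw [circConv_comm (kernel_isPeriodic d N) hf]
  let c : (Fin d → ℤ) → ℂ := fun k =>
    (((N / 2 : ℕ) : ℝ) + 1)⁻¹ * ((2 ^ d)⁻¹ * ∫ y in cube d, (f y : ℂ) * expMonomial (-k) y)
  have hI : ∀ k : Fin d → ℤ,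
      Integrable (fun y => (f y : ℂ) * expMonomial (-k) y) (volume.restrict (cube d)) := by
    intro k
    have hint' : IntegrableOn (fun y => (f y : ℂ)) (cube d) := hint.ofReal
    exact hint'.mul_continuousOn (continuous_expMonomial _).continuousOn (isCompact_cube d)
  have hD : ∀ x y, (kernel d N (x - y) : ℂ) = ∑ n ∈ Finset.Icc (N / 2) N,
      ∑ k ∈ multiIndices d n, (((N / 2 : ℕ) : ℝ) + 1 : ℂ)⁻¹ * ((2 ^ d)⁻¹ *
        (expMonomial k x * expMonomial (-k) y)) := by
    intro x y
    simp only [kernel, Complex.ofReal_mul, Complex.ofReal_sum, dirichletKernel_eq_expMonomial,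
      expMonomial_sub, Finset.mul_sum]
    push_cast
    rfl
  have key : circConv f (kernel d N) = fun x => ∑ n ∈ Finset.Icc (N / 2) N,
      ∑ k ∈ multiIndices d n, (c k * expMonomial k x).re := by
    ext x
    have : ((circConv f (kernel d N) x : ℝ) : ℂ) = ∑ n ∈ Finset.Icc (N / 2) N,
        ∑ k ∈ multiIndices d n, c k * expMonomial k x := by
      have hterm : ∀ y, ((f y * kernel d N (x - y) : ℝ) : ℂ) = ∑ n ∈ Finset.Icc (N / 2) N,
          ∑ k ∈ multiIndices d n, ((((N / 2 : ℕ) : ℝ) + 1 : ℂ)⁻¹ * (2 ^ d)⁻¹ * expMonomial k x) *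
            ((f y : ℂ) * expMonomial (-k) y) := by
        intro y
        rw [Complex.ofReal_mul, hD, Finset.mul_sum]
        refine Finset.sum_congr rfl fun n _ => ?_
        rw [Finset.mul_sum]
        refine Finset.sum_congr rfl fun k _ => ?_
        ring
      rw [circConv, ← integral_complex_ofReal]
      simp only [hterm]
      rw [integral_finsetSum _ fun n _ => integrable_finsetSum _ fun k _ => (hI k).const_mul _]
      refine Finset.sum_congr rfl fun n _ => ?_
      rw [integral_finsetSum _ fun k _ => (hI k).const_mul _]
      refine Finset.sum_congr rfl fun k _ => ?_
      rw [integral_const_mul]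
      simp only [c]
      push_cast
      ring
    have := congrArg Complex.re this
    simpa only [Complex.ofReal_re, Complex.re_sum] using this
  rw [key]
  exact trigPoly.sum_mem _ fun n hn => trigPoly.sum_mem _ fun k hk =>
    re_mul_expMonomial_mem_trigPoly (multiIndices_mono (Finset.mem_Icc.1 hn).2 hk) _

theorem circConv_kernel_eq_self {d N : ℕ} (hN : Even N) {f : (Fin d → ℝ) → ℝ}
    (hf : f ∈ trigPoly d (N / 2)) : circConv (kernel d N) f = f := by
  obtain ⟨c, hc⟩ := exists_coeff_of_mem_trigPoly hf
  ext x
  apply Complex.ofReal_injective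
  have hterm : ∀ y, ((kernel d N y * f (x - y) : ℝ) : ℂ) = ∑ k ∈ multiIndices d (N / 2),
      (c k * expMonomial k x) * ((kernel d N y : ℂ) * expMonomial (-k) y) := by
    intro y
    rw [Complex.ofReal_mul, hc, Finset.mul_sum]
    refine Finset.sum_congr rfl fun k _ => ?_
    rw [expMonomial_sub]
    ring
  rw [circConv, ← integral_complex_ofReal]
  simp only [hterm]
  rw [integral_finsetSum, hc]
  · refine Finset.sum_congr rfl fun k hk => ?_
    rw [integral_const_mul, integral_kernel_mul_expMonomial hN hk, mul_one]
  · intro k _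
    exact (((Complex.continuous_ofReal.comp (continuous_kernel d N)).mul
      (continuous_expMonomial _)).continuousOn.integrableOn_compact (isCompact_cube d)).const_mul _

/-! ### Integrals of negative powers of the distance from `1` to a circle -/

theorem norm_expi (k : ℤ) (t : ℝ) : ‖expi k t‖ = 1 := by
  rw [expi, show Complex.I * Real.pi * (k * t) = ((Real.pi * (k * t) : ℝ) : ℂ) * Complex.I by
    push_cast; ring]
  exact Complex.norm_exp_ofReal_mul_I _

theorem expi_add_two (k : ℤ) (t : ℝ) : expi k (t + 2) = expi k t := by
  rw [expi, expi, Complex.exp_eq_exp_iff_exists_int]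
  exact ⟨k, by push_cast; ring⟩

/-- The squared norm is `(1-r)^2 + 2r(1 - cos πt)`, and `1 - cos πt ≥ 2t^2`. The condition `r ≥ 1/4`
gives `4r ≥ 1`, hence the lower bound `(1-r)^2 + t^2`. -/
theorem half_le_norm_one_sub {r t : ℝ} (hr : 1 / 4 ≤ r) (hr1 : r ≤ 1) (ht : |t| ≤ 1) :
    (1 - r + |t|) / 2 ≤ ‖1 - r * expi 1 t‖ := by
  have hcos : Real.cos (Real.pi * t) ≤ 1 - 2 * t ^ 2 := by
    have h := Real.cos_le_one_sub_mul_cos_sq (x := Real.pi * t) (by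
      rw [abs_mul, abs_of_pos Real.pi_pos]
      exact mul_le_of_le_one_right Real.pi_pos.le ht)
    have h2 : 2 / Real.pi ^ 2 * (Real.pi * t) ^ 2 = 2 * t ^ 2 := by
      field_simp [Real.pi_ne_zero]
    rwa [h2] at h
  have hsq : ‖1 - r * expi 1 t‖ ^ 2 = (1 - r) ^ 2 + 2 * r * (1 - Real.cos (Real.pi * t)) := by
    rw [← Complex.normSq_eq_norm_sq, expi_eq, Complex.normSq_apply]
    simp only [Int.cast_one, one_mul, Complex.sub_re, Complex.one_re, Complex.re_ofReal_mul,
      Complex.add_re, Complex.ofReal_re, Complex.mul_I_re, Complex.ofReal_im, neg_zero, add_zero,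
      Complex.sub_im, Complex.one_im, Complex.im_ofReal_mul, Complex.add_im, Complex.mul_I_im]
    linear_combination r ^ 2 * Real.sin_sq_add_cos_sq (Real.pi * t)
  have hx : 0 ≤ 1 - r + |t| := by
    have := abs_nonneg t
    linarith
  refine (pow_le_pow_iff_left₀ (by positivity) (norm_nonneg _) two_ne_zero).1 ?_
  rw [hsq]
  nlinarith [sq_nonneg (1 - r - |t|), sq_abs t, sq_nonneg t]

theorem norm_one_sub_pos {w : ℂ} (hw : ‖w‖ < 1) : 0 < ‖1 - w‖ := by
  have := norm_sub_norm_le 1 w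
  rw [norm_one] at this
  linarith

theorem norm_ofReal_mul_expi {r : ℝ} (hr : 0 ≤ r) (k : ℤ) (t : ℝ) : ‖(r : ℂ) * expi k t‖ = r := by
  rw [norm_mul, norm_expi, mul_one, Complex.norm_of_nonneg hr]

/-- The integral of `‖1 - w‖⁻¹⁻ˢ` over the circle `‖w‖ = r`. -/
noncomputable def circleMoment (r s : ℝ) : ℝ :=
  ∫ t in (-1 : ℝ)..1, ‖1 - r * expi 1 t‖ ^ (-(1 + s))

theorem continuous_norm_one_sub_rpow {r : ℝ} (hr : 0 ≤ r) (hr1 : r < 1) (s : ℝ) :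
    Continuous fun t => ‖1 - r * expi 1 t‖ ^ s := by
  refine Continuous.rpow_const ?_ fun t => Or.inl (norm_one_sub_pos ?_).ne'
  · exact (continuous_const.sub (continuous_const.mul (continuous_expi 1))).norm
  · rwa [norm_ofReal_mul_expi hr]

theorem integral_add_rpow_le {a s : ℝ} (ha : 0 < a) (hs : 0 < s) :
    ∫ t in (0 : ℝ)..1, (a + t) ^ (-(1 + s)) ≤ a ^ (-s) / s := by
  rw [intervalIntegral.integral_comp_add_left (fun t => t ^ (-(1 + s))),
    integral_rpow (Or.inr ⟨by linarith, ?_⟩)]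
  · rw [show -(1 + s) + 1 = -s by ring, div_neg, ← neg_div, add_zero]
    gcongr
    have : 0 ≤ (a + 1) ^ (-s) := by positivity
    linarith
  · rw [Set.uIcc_of_le (by linarith), Set.mem_Icc]
    intro h
    linarith [h.1]

/-- The factor 8 is `2^(1+s) ≤ 4`, from the halved lower bound on the distance, times the two halves
of the circle. -/
theorem circleMoment_le {r s : ℝ} (hr : 1 / 4 ≤ r) (hr1 : r < 1) (hs : 0 < s) (hs1 : s ≤ 1) :
    circleMoment r s ≤ 8 * ((1 - r) ^ (-s) / s) := by
  have ha : 0 < 1 - r := by linarith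
  have hpow : ∀ x : ℝ, 0 < x → (x / 2) ^ (-(1 + s)) ≤ 4 * x ^ (-(1 + s)) := by
    intro x hx
    rw [Real.div_rpow hx.le zero_le_two, Real.rpow_neg zero_le_two, div_inv_eq_mul, mul_comm]
    gcongr
    calc (2 : ℝ) ^ (1 + s) ≤ 2 ^ (2 : ℝ) := by gcongr <;> linarith
      _ = 4 := by norm_num
  have hle : ∀ t : ℝ, |t| ≤ 1 →
      ‖1 - r * expi 1 t‖ ^ (-(1 + s)) ≤ 4 * (1 - r + |t|) ^ (-(1 + s)) := by
    intro t ht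
    have hx : 0 < 1 - r + |t| := by positivity
    refine (Real.rpow_le_rpow_of_nonpos (by positivity)
      (half_le_norm_one_sub hr hr1.le ht) (by linarith)).trans (hpow _ hx)
  have hc := fun a b => (continuous_norm_one_sub_rpow (by linarith) hr1 (-(1 + s))).intervalIntegrable
    (μ := volume) a b
  have hci : IntervalIntegrable (fun t => 4 * (1 - r + t) ^ (-(1 + s))) volume 0 1 := by
    refine ContinuousOn.intervalIntegrable ?_
    rw [Set.uIcc_of_le zero_le_one]
    refine continuousOn_const.mul (ContinuousOn.rpow_const (by fun_prop) fun t ht => Or.inl ?_)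
    have := ht.1
    positivity
  have hpos : ∫ t in (0 : ℝ)..1, ‖1 - r * expi 1 t‖ ^ (-(1 + s)) ≤ 4 * ((1 - r) ^ (-s) / s) := by
    refine (intervalIntegral.integral_mono_on zero_le_one (hc 0 1) hci fun t ht => ?_).trans ?_
    · have := hle t (by rw [abs_of_nonneg ht.1]; exact ht.2)
      rwa [abs_of_nonneg ht.1] at this
    · rw [intervalIntegral.integral_const_mul]
      gcongr
      exact integral_add_rpow_le ha hs
  have hneg : ∫ t in (-1 : ℝ)..0, ‖1 - r * expi 1 t‖ ^ (-(1 + s))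
      ≤ 4 * ((1 - r) ^ (-s) / s) := by
    have h := intervalIntegral.integral_comp_neg (a := 0) (b := 1)
      (fun t => ‖1 - r * expi 1 t‖ ^ (-(1 + s)))
    rw [neg_zero] at h
    rw [← h]
    have hc' := ((continuous_norm_one_sub_rpow (by linarith) hr1 (-(1 + s))).comp
      continuous_neg).intervalIntegrable (μ := volume) 0 1
    refine (intervalIntegral.integral_mono_on zero_le_one hc' hci fun t ht => ?_).trans ?_
    · have := hle (-t) (by rw [abs_neg, abs_of_nonneg ht.1]; exact ht.2)
      rwa [abs_neg, abs_of_nonneg ht.1] at this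
    · rw [intervalIntegral.integral_const_mul]
      gcongr
      exact integral_add_rpow_le ha hs
  rw [circleMoment, ← intervalIntegral.integral_add_adjacent_intervals (hc (-1) 0) (hc 0 1)]
  linarith

theorem integral_comp_add_eq_circleMoment (r s τ : ℝ) :
    ∫ x in (-1 : ℝ)..1, ‖1 - r * expi 1 (τ + x)‖ ^ (-(1 + s)) = circleMoment r s := by
  have hp : Function.Periodic (fun t => ‖1 - r * expi 1 t‖ ^ (-(1 + s))) 2 := fun t => by
    simp only [expi_add_two]
  have h := hp.intervalIntegral_add_eq (τ + -1) (-1)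
  rw [intervalIntegral.integral_comp_add_left (fun t => ‖1 - r * expi 1 t‖ ^ (-(1 + s))),
    circleMoment]
  convert h using 2 <;> ring

theorem integral_comp_sub_eq_circleMoment (r s τ : ℝ) :
    ∫ x in (-1 : ℝ)..1, ‖1 - r * expi 1 (τ - x)‖ ^ (-(1 + s)) = circleMoment r s := by
  have h := intervalIntegral.integral_comp_neg (a := -1) (b := 1)
      (fun x => ‖1 - r * expi 1 (τ + x)‖ ^ (-(1 + s)))
  rw [neg_neg, integral_comp_add_eq_circleMoment] at h
  exact h

/-! ### Partial sums of the Poisson kernel with a complex parameter -/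

/-- Since `D ≤ 2v`, the factor `D^(1-p)` is absorbed by `v`. This keeps only a small power of `D`
and moves the whole singularity to the smaller factor `u`. -/
theorem div_mul_le_rpow_of_le_add {D u v p : ℝ} (hD : 0 ≤ D) (hu : 0 < u) (huv : u ≤ v)
    (hDuv : D ≤ u + v) (hp : 0 < p) (hp1 : p ≤ 1) :
    D / (u * v) ≤ 2 * D ^ p * u ^ (-(1 + p)) := by
  have hv : 0 < v := hu.trans_le huv
  have h1 : D = D ^ p * D ^ (1 - p) := by
    rcases hD.eq_or_lt with h | h
    · rw [← h, Real.zero_rpow hp.ne', zero_mul]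
    · rw [← Real.rpow_add h, add_sub_cancel, Real.rpow_one]
  have h2 : D ^ (1 - p) ≤ 2 * v ^ (1 - p) := by
    calc D ^ (1 - p) ≤ (2 * v) ^ (1 - p) :=
          Real.rpow_le_rpow hD (by linarith) (by linarith)
      _ = 2 ^ (1 - p) * v ^ (1 - p) := Real.mul_rpow zero_le_two hv.le
      _ ≤ 2 * v ^ (1 - p) := by
          gcongr
          exact Real.rpow_le_self_of_one_le one_le_two (by linarith)
  have h3 : v ^ (1 - p) / v = v ^ (-p) := by
    rw [sub_eq_add_neg, Real.rpow_add hv, Real.rpow_one, mul_div_cancel_left₀ _ hv.ne']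
  have h4 : u ^ (-(1 + p)) = u ^ (-p) / u := by
    rw [neg_add, Real.rpow_add hu, Real.rpow_neg_one]
    ring
  have h5 : v ^ (-p) ≤ u ^ (-p) := Real.rpow_le_rpow_of_nonpos hu huv (by linarith)
  calc D / (u * v) = D ^ p * D ^ (1 - p) / (u * v) := by rw [← h1]
    _ ≤ D ^ p * (2 * v ^ (1 - p)) / (u * v) := by gcongr
    _ = 2 * D ^ p * (v ^ (1 - p) / v / u) := by field_simp
    _ ≤ 2 * D ^ p * (u ^ (-p) / u) := by rw [h3]; gcongr
    _ = _ := by rw [h4]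

theorem norm_one_sub_mul_div_le {α β : ℂ} {p : ℝ} (hα : ‖α‖ < 1) (hβ : ‖β‖ < 1)
    (hp : 0 < p) (hp1 : p ≤ 1) : ‖(1 - α * β) / ((1 - α) * (1 - β))‖
      ≤ 2 * ‖1 - α * β‖ ^ p * (‖1 - α‖ ^ (-(1 + p)) + ‖1 - β‖ ^ (-(1 + p))) := by
  have hu := norm_one_sub_pos hα
  have hv := norm_one_sub_pos hβ
  have hD : ‖1 - α * β‖ ≤ ‖1 - α‖ + ‖1 - β‖ := by
    -- This splitting gives the hypothesis `D ≤ u + v` of the preceding lemma.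
    calc ‖1 - α * β‖ = ‖(1 - α) + α * (1 - β)‖ := by ring_nf
      _ ≤ ‖1 - α‖ + ‖α‖ * ‖1 - β‖ := by
          rw [← norm_mul]
          exact norm_add_le _ _
      _ ≤ _ := by
          gcongr
          exact mul_le_of_le_one_left hv.le hα.le
  rw [norm_div, norm_mul, mul_add]
  have hpu : 0 ≤ 2 * ‖1 - α * β‖ ^ p * ‖1 - α‖ ^ (-(1 + p)) := by positivity
  have hpv : 0 ≤ 2 * ‖1 - α * β‖ ^ p * ‖1 - β‖ ^ (-(1 + p)) := by positivity
  rcases le_total ‖1 - α‖ ‖1 - β‖ with h | h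
  · have := div_mul_le_rpow_of_le_add (norm_nonneg _) hu h hD hp hp1
    linarith
  · have := div_mul_le_rpow_of_le_add (norm_nonneg _) hv h (by linarith) hp hp1
    rw [mul_comm ‖1 - β‖] at this
    linarith

/-- The partial sum `∑_{|k| ≤ K} w^|k| exp (iπkx)` of the Poisson kernel. -/
noncomputable def poissonSum (K : ℕ) (w : ℂ) (x : ℝ) : ℂ :=
  ∑ k ∈ Finset.Icc (-(K : ℤ)) K, w ^ k.natAbs * expi k x

theorem expi_one_pow (n : ℕ) (x : ℝ) : expi 1 x ^ n = expi n x := by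
  rw [expi, expi, ← Complex.exp_nat_mul]
  push_cast
  ring_nf

theorem expi_neg_one_pow (n : ℕ) (x : ℝ) : expi (-1) x ^ n = expi (-n) x := by
  rw [expi, expi, ← Complex.exp_nat_mul]
  push_cast
  ring_nf

/-- The frequencies `k ≥ 0` and `k ≤ 0` form geometric sums; frequency zero, counted twice, is
subtracted. -/
theorem poissonSum_eq (K : ℕ) (w : ℂ) (x : ℝ) :
    poissonSum K w x = ∑ j ∈ Finset.range (K + 1), (w * expi 1 x) ^ j
      + ∑ j ∈ Finset.range (K + 1), (w * expi (-1) x) ^ j - 1 := by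
  induction K with
  | zero => simp [poissonSum, expi]
  | succ K ih =>
    have hI : Finset.Icc (-((K + 1 : ℕ) : ℤ)) ((K + 1 : ℕ) : ℤ)
        = insert (-((K + 1 : ℕ) : ℤ)) (insert ((K + 1 : ℕ) : ℤ) (Finset.Icc (-(K : ℤ)) K)) := by
      ext k
      simp only [Finset.mem_Icc, Finset.mem_insert]
      push_cast
      omega
    rw [Finset.sum_range_succ _ (K + 1), Finset.sum_range_succ _ (K + 1), poissonSum, hI,
      Finset.sum_insert, Finset.sum_insert, ← poissonSum, ih]
    · simp only [mul_pow, expi_one_pow, expi_neg_one_pow, Int.natAbs_neg, Int.natAbs_natCast]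
      ring
    · simp only [Finset.mem_Icc]
      push_cast
      omega
    · simp only [Finset.mem_insert, Finset.mem_Icc]
      push_cast
      omega

/-- The main term is the full series in closed form. Each of the two truncation errors is at most
`1/2`, because `‖1 - γ‖ ≥ 1 - r` and `K` is large; together they give the final `1`. -/
theorem norm_poissonSum_le {r p : ℝ} {w : ℂ} {K : ℕ} {x : ℝ} (hw : ‖w‖ = r) (hr1 : r < 1)
    (hp : 0 < p) (hp1 : p ≤ 1) (hK : r ^ (K + 1) ≤ (1 - r) / 2) :
    ‖poissonSum K w x‖ ≤ 2 * ‖1 - w ^ 2‖ ^ p *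
      (‖1 - w * expi 1 x‖ ^ (-(1 + p)) + ‖1 - w * expi (-1) x‖ ^ (-(1 + p))) + 1 := by
  set α := w * expi 1 x with hαdef
  set β := w * expi (-1) x with hβdef
  have hα : ‖α‖ = r := by rw [hαdef, norm_mul, norm_expi, mul_one, hw]
  have hβ : ‖β‖ = r := by rw [hβdef, norm_mul, norm_expi, mul_one, hw]
  have hαβ : α * β = w ^ 2 := by
    rw [hαdef, hβdef, expi, expi, mul_mul_mul_comm, ← Complex.exp_add]
    push_cast
    ring_nf
    simp
  have ha : 0 < 1 - r := by linarith
  have hdist : ∀ γ : ℂ, ‖γ‖ = r → ‖γ ^ (K + 1) / (1 - γ)‖ ≤ 1 / 2 := by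
    intro γ hγ
    have h1 : 1 - r ≤ ‖1 - γ‖ := by
      have := norm_sub_norm_le 1 γ
      rwa [norm_one, hγ] at this
    rw [norm_div, norm_pow, hγ, div_le_iff₀ (ha.trans_le h1)]
    linarith
  have hne : ∀ γ : ℂ, ‖γ‖ = r → 1 - γ ≠ 0 := fun γ hγ =>
    norm_pos_iff.1 (norm_one_sub_pos (hγ.trans_lt hr1))
  have hne' : ∀ γ : ℂ, ‖γ‖ = r → γ ≠ 1 := fun γ hγ h => hne γ hγ (by rw [h, sub_self])
  have hα0 := hne α hα
  have hβ0 := hne β hβ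
  have hgeom : ∀ γ : ℂ, ‖γ‖ = r →
      ∑ j ∈ Finset.range (K + 1), γ ^ j = (1 - γ ^ (K + 1)) / (1 - γ) := by
    intro γ hγ
    rw [geom_sum_eq (hne' γ hγ), ← neg_div_neg_eq, neg_sub, neg_sub]
  have hQ : poissonSum K w x = (1 - α * β) / ((1 - α) * (1 - β))
      - (α ^ (K + 1) / (1 - α) + β ^ (K + 1) / (1 - β)) := by
    rw [poissonSum_eq, hgeom α hα, hgeom β hβ]
    field_simp
    ring
  rw [hQ, ← hαβ]
  refine (norm_sub_le _ _).trans (add_le_add (norm_one_sub_mul_div_le (hα.trans_lt hr1)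
    (hβ.trans_lt hr1) hp hp1) ((norm_add_le _ _).trans ?_))
  linarith [hdist α hα, hdist β hβ]

theorem continuous_poissonSum (K : ℕ) (w : ℂ) : Continuous (poissonSum K w) :=
  continuous_finsetSum _ fun _ _ => continuous_const.mul (continuous_expi _)

theorem expi_one_add (τ x : ℝ) : expi 1 τ * expi 1 x = expi 1 (τ + x) := by
  simp only [expi]
  rw [← Complex.exp_add]
  push_cast
  ring_nf

theorem expi_one_sub (τ x : ℝ) : expi 1 τ * expi (-1) x = expi 1 (τ - x) := by
  rw [expi_sub]

theorem integral_norm_poissonSum_le {r p : ℝ} {K : ℕ} (hr : 1 / 4 ≤ r) (hr1 : r < 1)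
    (hp : 0 < p) (hp1 : p ≤ 1) (hK : r ^ (K + 1) ≤ (1 - r) / 2) (τ : ℝ) :
    ∫ x in (-1 : ℝ)..1, ‖poissonSum K (r * expi 1 τ) x‖
      ≤ (64 / p + 2) * (‖1 - r * expi 1 τ‖ / (1 - r)) ^ p := by
  have hr0 : 0 ≤ r := by linarith
  have ha : 0 < 1 - r := by linarith
  set w : ℂ := r * expi 1 τ with hwdef
  have hw : ‖w‖ = r := norm_ofReal_mul_expi hr0 1 τ
  have hb : 1 - r ≤ ‖1 - w‖ := by
    have := norm_sub_norm_le 1 w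
    rwa [norm_one, hw] at this
  have hsq : ‖1 - w ^ 2‖ ^ p ≤ 2 * ‖1 - w‖ ^ p := by
    have h1 : ‖1 - w ^ 2‖ ≤ 2 * ‖1 - w‖ := by
      rw [show 1 - w ^ 2 = (1 + w) * (1 - w) by ring, norm_mul]
      gcongr
      refine (norm_add_le _ _).trans ?_
      rw [norm_one, hw]
      linarith
    calc ‖1 - w ^ 2‖ ^ p ≤ (2 * ‖1 - w‖) ^ p := by gcongr
      _ = 2 ^ p * ‖1 - w‖ ^ p := Real.mul_rpow zero_le_two (norm_nonneg _)
      _ ≤ _ := by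
        gcongr
        exact Real.rpow_le_self_of_one_le one_le_two hp1
  have hc1 : Continuous fun x => ‖1 - r * expi 1 (τ + x)‖ ^ (-(1 + p)) :=
    (continuous_norm_one_sub_rpow hr0 hr1 _).comp (continuous_const.add continuous_id)
  have hc2 : Continuous fun x => ‖1 - r * expi 1 (τ - x)‖ ^ (-(1 + p)) :=
    (continuous_norm_one_sub_rpow hr0 hr1 _).comp (continuous_const.sub continuous_id)
  have hc : Continuous fun x => 2 * ‖1 - w ^ 2‖ ^ p *
      (‖1 - r * expi 1 (τ + x)‖ ^ (-(1 + p)) + ‖1 - r * expi 1 (τ - x)‖ ^ (-(1 + p))) :=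
    continuous_const.mul (hc1.add hc2)
  have hle : ∀ x, ‖poissonSum K w x‖ ≤ 2 * ‖1 - w ^ 2‖ ^ p *
      (‖1 - r * expi 1 (τ + x)‖ ^ (-(1 + p)) + ‖1 - r * expi 1 (τ - x)‖ ^ (-(1 + p))) + 1 := by
    intro x
    have h := norm_poissonSum_le (x := x) hw hr1 hp hp1 hK
    rwa [hwdef, mul_assoc _ _ (expi 1 x), mul_assoc _ _ (expi (-1) x), expi_one_add,
      expi_one_sub, ← hwdef] at h
  have hone : 1 ≤ (‖1 - w‖ / (1 - r)) ^ p :=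
    Real.one_le_rpow ((one_le_div ha).2 hb) hp.le
  calc ∫ x in (-1 : ℝ)..1, ‖poissonSum K w x‖
      ≤ ∫ x in (-1 : ℝ)..1, (2 * ‖1 - w ^ 2‖ ^ p *
        (‖1 - r * expi 1 (τ + x)‖ ^ (-(1 + p)) + ‖1 - r * expi 1 (τ - x)‖ ^ (-(1 + p))) + 1) :=
        intervalIntegral.integral_mono (by norm_num)
          ((continuous_poissonSum K w).norm.intervalIntegrable _ _)
          ((hc.add continuous_const).intervalIntegrable _ _) hle
    _ = 2 * ‖1 - w ^ 2‖ ^ p * (circleMoment r p + circleMoment r p) + 2 := by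
        rw [intervalIntegral.integral_add
          (hc.intervalIntegrable _ _) intervalIntegrable_const,
          intervalIntegral.integral_const_mul, intervalIntegral.integral_add
          (hc1.intervalIntegrable _ _) (hc2.intervalIntegrable _ _),
          integral_comp_add_eq_circleMoment, integral_comp_sub_eq_circleMoment]
        norm_num
    -- The 64 is `2 * 2 * (8 + 8)`. The trailing 2 is the integral of the truncation error, absorbed
    -- afterwards because the ratio in `hone` is at least 1.
    _ ≤ 2 * (2 * ‖1 - w‖ ^ p) * (8 * ((1 - r) ^ (-p) / p) + 8 * ((1 - r) ^ (-p) / p)) + 2 * 1 := by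
        have := circleMoment_le hr hr1 hp hp1
        have h0 : 0 ≤ circleMoment r p :=
          intervalIntegral.integral_nonneg (by norm_num) fun _ _ => by positivity
        rw [mul_one]
        gcongr
    _ = 64 / p * (‖1 - w‖ / (1 - r)) ^ p + 2 * 1 := by
        rw [Real.div_rpow (norm_nonneg _) ha.le, Real.rpow_neg ha.le]
        ring
    _ ≤ 64 / p * (‖1 - w‖ / (1 - r)) ^ p + 2 * (‖1 - w‖ / (1 - r)) ^ p := by gcongr
    _ = _ := by ring

/-! ### Sums of Dirichlet kernels -/

theorem expi_add_index (k l : ℤ) (t : ℝ) : expi k t * expi l t = expi (k + l) t := by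
  rw [expi, expi, expi, ← Complex.exp_add]
  push_cast
  ring_nf

/-- The weight `∑_{i, j < n} w^(i - j)` on the circle `w = r exp (iπt)`; its Fourier
coefficients of index `-m ≤ 0` are `(n - m)₊ r⁻ᵐ`. -/
noncomputable def fejerWeight (n : ℕ) (r t : ℝ) : ℂ :=
  (∑ i ∈ Finset.range n, (r * expi 1 t) ^ i) * ∑ j ∈ Finset.range n, ((r⁻¹ : ℝ) * expi (-1) t) ^ j

theorem continuous_fejerWeight (n : ℕ) (r : ℝ) : Continuous (fejerWeight n r) :=
  (continuous_finsetSum _ fun _ _ => (continuous_const.mul (continuous_expi _)).pow _).mul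
    (continuous_finsetSum _ fun _ _ => (continuous_const.mul (continuous_expi _)).pow _)

/-- Only the terms with `j = i + m` survive integration. The count of `j < n` with `m ≤ j` is the
number of kernels of order below `n` that contain a frequency of `ℓ¹` norm `m`. -/
theorem integral_fejerWeight_mul_pow {r : ℝ} (hr : r ≠ 0) (n m : ℕ) :
    ∫ t in (-1 : ℝ)..1, fejerWeight n r t * (r * expi 1 t) ^ m
      = 2 * ∑ j ∈ Finset.range n, if m ≤ j then 1 else 0 := by
  have hterm : ∀ t, fejerWeight n r t * (r * expi 1 t) ^ m =
      ∑ j ∈ Finset.range n, ∑ i ∈ Finset.range n,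
        ((r ^ i * r⁻¹ ^ j * r ^ m : ℝ) : ℂ) * expi (i + m - j) t := by
    intro t
    rw [fejerWeight, mul_comm (∑ i ∈ Finset.range n, _), Finset.sum_mul_sum, Finset.sum_mul]
    refine Finset.sum_congr rfl fun j _ => ?_
    rw [Finset.sum_mul]
    refine Finset.sum_congr rfl fun i _ => ?_
    rw [mul_pow, mul_pow, mul_pow, expi_one_pow, expi_one_pow, expi_neg_one_pow,
      show (i + m - j : ℤ) = -j + i + m by ring, ← expi_add_index, ← expi_add_index]
    push_cast
    ring
  have hint : ∀ (c : ℂ) (k : ℤ), IntervalIntegrable (fun t => c * expi k t) volume (-1) 1 :=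
    fun c k => (continuous_const.mul (continuous_expi k)).intervalIntegrable _ _
  simp only [hterm]
  rw [intervalIntegral.integral_finsetSum, Finset.mul_sum]
  · refine Finset.sum_congr rfl fun j hj => ?_
    rw [intervalIntegral.integral_finsetSum fun i _ => hint _ _]
    simp only [intervalIntegral.integral_const_mul, integral_expi]
    rw [Finset.mem_range] at hj
    split_ifs with h
    · rw [Finset.sum_eq_single_of_mem (j - m) (Finset.mem_range.2 (by omega))]
      · rw [if_pos (by omega)]
        have : r ^ (j - m) * r⁻¹ ^ j * r ^ m = 1 := by
          rw [mul_right_comm, ← pow_add, Nat.sub_add_cancel h, ← mul_pow, mul_inv_cancel₀ hr,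
            one_pow]
        rw [this]
        simp
      · intro i _ hi
        rw [if_neg (by omega), mul_zero]
    · rw [mul_zero]
      refine Finset.sum_eq_zero fun i _ => ?_
      rw [if_neg (by omega), mul_zero]
  · intro j _
    exact (continuous_finsetSum _ fun i _ =>
      continuous_const.mul (continuous_expi _)).intervalIntegrable _ _

/-- Both factors are geometric sums. The one in `w⁻¹` stays under control because `r⁻¹ ^ n ≤ 3` and
`‖w⁻¹ - 1‖ = ‖1 - w‖ / r`. -/
theorem norm_fejerWeight_le {n : ℕ} {r : ℝ} (hr : 0 < r) (hr1 : r < 1) (hrn : r⁻¹ ^ n ≤ 3) (t : ℝ) :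
    ‖fejerWeight n r t‖ ≤ 8 / ‖1 - r * expi 1 t‖ ^ 2 := by
  set w : ℂ := r * expi 1 t with hwdef
  have hw : ‖w‖ = r := norm_ofReal_mul_expi hr.le 1 t
  have hw0 : w ≠ 0 := norm_pos_iff.1 (hw ▸ hr)
  have hb : 0 < ‖1 - w‖ := norm_one_sub_pos (hw.trans_lt hr1)
  have hw1 : w ≠ 1 := fun h => hb.ne' (by rw [h, sub_self, norm_zero])
  have hinv : ((r⁻¹ : ℝ) : ℂ) * expi (-1) t = w⁻¹ := by
    refine eq_inv_of_mul_eq_one_right ?_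
    rw [hwdef, mul_mul_mul_comm, expi_add_index]
    have : (r : ℂ) ≠ 0 := Complex.ofReal_ne_zero.2 hr.ne'
    simp [expi, this]
  have h1 : ‖∑ i ∈ Finset.range n, w ^ i‖ ≤ 2 / ‖1 - w‖ := by
    rw [geom_sum_eq hw1, norm_div, norm_sub_rev w]
    gcongr
    refine (norm_sub_le _ _).trans ?_
    rw [norm_pow, hw, norm_one]
    linarith [pow_le_one₀ (n := n) hr.le hr1.le]
  have h2 : ‖∑ j ∈ Finset.range n, w⁻¹ ^ j‖ ≤ 4 / ‖1 - w‖ := by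
    rw [geom_sum_eq (inv_ne_one.2 hw1), norm_div]
    have h3 : ‖1 - w‖ ≤ ‖w⁻¹ - 1‖ := by
      rw [show w⁻¹ - 1 = w⁻¹ * (1 - w) by rw [mul_sub, inv_mul_cancel₀ hw0, mul_one], norm_mul,
        norm_inv, hw]
      exact le_mul_of_one_le_left hb.le ((one_le_inv₀ hr).2 hr1.le)
    have h4 : ‖w⁻¹ ^ n - 1‖ ≤ 4 := by
      refine (norm_sub_le _ _).trans ?_
      rw [norm_pow, norm_inv, hw, norm_one]
      linarith
    gcongr
  rw [fejerWeight, hinv, norm_mul]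
  calc _ ≤ 2 / ‖1 - w‖ * (4 / ‖1 - w‖) := by gcongr
    _ = _ := by
      field_simp
      norm_num

theorem prod_poissonSum {d : ℕ} (K : ℕ) (w : ℂ) (z : Fin d → ℝ) :
    ∏ i, poissonSum K w (z i) = ∑ k ∈ Fintype.piFinset fun _ : Fin d => Finset.Icc (-(K : ℤ)) K,
      w ^ (∑ i, (k i).natAbs) * expMonomial k z := by
  simp only [poissonSum, Finset.prod_univ_sum]
  refine Finset.sum_congr rfl fun k _ => ?_
  rw [Finset.prod_mul_distrib, Finset.prod_pow_eq_pow_sum, expMonomial]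

theorem mem_multiIndices_iff_natAbs {d N : ℕ} {k : Fin d → ℤ} :
    k ∈ multiIndices d N ↔ ∑ i, (k i).natAbs ≤ N := by
  rw [mem_multiIndices]
  simp only [Int.abs_eq_natAbs]
  exact_mod_cast Iff.rfl

theorem sum_multiIndices_eq {d j K : ℕ} (hj : j ≤ K) (F : (Fin d → ℤ) → ℂ) :
    ∑ k ∈ multiIndices d j, F k = ∑ k ∈ Fintype.piFinset fun _ : Fin d => Finset.Icc (-(K : ℤ)) K,
      (if ∑ i, (k i).natAbs ≤ j then 1 else 0) * F k := by
  simp only [ite_mul, one_mul, zero_mul]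
  rw [← Finset.sum_filter]
  refine Finset.sum_congr ?_ fun _ _ => rfl
  ext k
  rw [Finset.mem_filter, ← mem_multiIndices_iff_natAbs]
  refine ⟨fun h => ⟨?_, h⟩, fun h => h.2⟩
  have := multiIndices_mono hj h
  rw [multiIndices, Finset.mem_filter] at this
  exact this.1

/-- The weight annihilates every frequency of `ℓ¹` norm at least `n`, so any truncation `K ≥ n`
gives the same integral; `K` remains free to make the truncation error small. -/
theorem sum_dirichletKernel_eq_integral {d n K : ℕ} {r : ℝ} (hr : r ≠ 0) (hK : n ≤ K)
    (z : Fin d → ℝ) :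
    (2 : ℂ) * (2 ^ d * ((∑ j ∈ Finset.range n, dirichletKernel d j z : ℝ) : ℂ))
      = ∫ t in (-1 : ℝ)..1, fejerWeight n r t * ∏ i, poissonSum K (r * expi 1 t) (z i) := by
  simp only [prod_poissonSum, Finset.mul_sum]
  rw [intervalIntegral.integral_finsetSum]
  · have hI : ∀ k : Fin d → ℤ, ∫ t in (-1 : ℝ)..1, fejerWeight n r t *
        ((r * expi 1 t) ^ (∑ i, (k i).natAbs) * expMonomial k z)
        = 2 * ((∑ j ∈ Finset.range n, if ∑ i, (k i).natAbs ≤ j then 1 else 0) *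
          expMonomial k z) := by
      intro k
      simp only [← mul_assoc]
      rw [intervalIntegral.integral_mul_const, integral_fejerWeight_mul_pow hr]
    simp only [hI]
    rw [← Finset.mul_sum]
    congr 1
    simp only [Finset.sum_mul]
    rw [Finset.sum_comm]
    push_cast
    rw [Finset.mul_sum]
    refine Finset.sum_congr rfl fun j hj => ?_
    rw [dirichletKernel_eq_expMonomial, mul_inv_cancel_left₀ (pow_ne_zero _ two_ne_zero),
      sum_multiIndices_eq ((Finset.mem_range.1 hj).le.trans hK)]
  · intro k _
    exact ((continuous_fejerWeight n r).mul (((continuous_const.mul (continuous_expi 1)).pow _).mul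
      continuous_const)).intervalIntegrable _ _

theorem continuous_poissonSum_uncurry (K : ℕ) (r : ℝ) :
    Continuous fun q : ℝ × ℝ => poissonSum K (r * expi 1 q.1) q.2 := by
  unfold poissonSum
  exact continuous_finsetSum _ fun _ _ => ((continuous_const.mul
    ((continuous_expi 1).comp continuous_fst)).pow _).mul ((continuous_expi _).comp continuous_snd)

theorem integral_norm_sum_dirichletKernel_le_integral {d n K : ℕ} {r : ℝ} (hr : r ≠ 0)
    (hK : n ≤ K) : ∫ z in cube d, |∑ j ∈ Finset.range n, dirichletKernel d j z|
      ≤ ∫ t in (-1 : ℝ)..1, ‖fejerWeight n r t‖ *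
        (∫ x in (-1 : ℝ)..1, ‖poissonSum K (r * expi 1 t) x‖) ^ d := by
  let H : (Fin d → ℝ) → ℝ → ℝ := fun z t =>
    ‖fejerWeight n r t‖ * ∏ i, ‖poissonSum K (r * expi 1 t) (z i)‖
  have hi : ∀ i, Continuous fun q : (Fin d → ℝ) × ℝ => poissonSum K (r * expi 1 q.2) (q.1 i) := by
    intro i
    have hq : Continuous fun q : (Fin d → ℝ) × ℝ => (q.2, q.1 i) := by fun_prop
    have h := (continuous_poissonSum_uncurry K r).comp hq
    simpa only [Function.comp_def] using h
  have hH : Continuous (Function.uncurry H) := by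
    change Continuous fun q : (Fin d → ℝ) × ℝ =>
      ‖fejerWeight n r q.2‖ * ∏ i, ‖poissonSum K (r * expi 1 q.2) (q.1 i)‖
    exact ((continuous_fejerWeight n r).comp continuous_snd).norm.mul
      (continuous_finsetProd _ fun i _ => (hi i).norm)
  have hHint : Integrable (Function.uncurry H)
      ((volume.restrict (cube d)).prod (volume.restrict (Set.Icc (-1) 1))) := by
    have hc : IsCompact (cube d ×ˢ Set.Icc (-1 : ℝ) 1) := (isCompact_cube d).prod isCompact_Icc
    rw [Measure.prod_restrict, ← Measure.volume_eq_prod]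
    exact ContinuousOn.integrableOn_compact (μ := volume) hc hH.continuousOn
  have hbound : ∀ z, |∑ j ∈ Finset.range n, dirichletKernel d j z|
      ≤ ∫ t in Set.Icc (-1 : ℝ) 1, H z t := by
    intro z
    have h := congrArg norm (sum_dirichletKernel_eq_integral hr hK z)
    rw [norm_mul, norm_mul, norm_pow, Complex.norm_ofNat, Complex.norm_real, Real.norm_eq_abs] at h
    -- The normalization is simply discarded, as it only improves the bound.
    have h1 : (1 : ℝ) ≤ 2 * 2 ^ d := by
      have : (1 : ℝ) ≤ 2 ^ d := one_le_pow₀ one_le_two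
      linarith
    calc _ ≤ 2 * 2 ^ d * |∑ j ∈ Finset.range n, dirichletKernel d j z| :=
          le_mul_of_one_le_left (abs_nonneg _) h1
      _ = _ := by rw [mul_assoc, h]
      _ ≤ _ := intervalIntegral.norm_integral_le_integral_norm (by norm_num)
      _ = _ := by
          rw [setIntegral_Icc_neg_one_one]
          simp only [H, norm_mul, norm_prod]
  calc _ ≤ ∫ z in cube d, ∫ t in Set.Icc (-1 : ℝ) 1, H z t := by
        refine integral_mono ?_ hHint.integral_prod_left hbound
        exact ((continuous_finsetSum _ fun j _ =>
          continuous_dirichletKernel d j).abs).continuousOn.integrableOn_compact (isCompact_cube d)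
    _ = ∫ t in Set.Icc (-1 : ℝ) 1, ∫ z in cube d, H z t := integral_integral_swap hHint
    _ = _ := by
        rw [setIntegral_Icc_neg_one_one]
        refine intervalIntegral.integral_congr fun t _ => ?_
        simp only [H]
        rw [integral_const_mul, volume_restrict_cube,
          integral_fintype_prod_eq_prod fun _ x => ‖poissonSum K (r * expi 1 t) x‖]
        simp only [setIntegral_Icc_neg_one_one, Finset.prod_const, Finset.card_univ,
          Fintype.card_fin]

/-- The constant in the bound of the `L¹` norm of sums of Dirichlet kernels. -/
noncomputable def fejerConst (d : ℕ) : ℝ := 128 * (64 / (1 / (2 * d) : ℝ) + 2) ^ d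

/-- The base equals `1 + 1/n`, so the power is at most `e`. -/
theorem inv_one_sub_inv_pow_le (n : ℕ) : (1 - 1 / (n + 1 : ℝ))⁻¹ ^ n ≤ 3 := by
  rcases n.eq_zero_or_pos with rfl | hn
  · norm_num
  have hn' : (0 : ℝ) < n := Nat.cast_pos.2 hn
  have h : (1 - 1 / (n + 1 : ℝ))⁻¹ = 1 + 1 / n := by
    have h' : 1 - 1 / (n + 1 : ℝ) = n / (n + 1) := by
      field_simp
      ring
    rw [h', inv_div, add_div, div_self hn'.ne']
  calc (1 - 1 / (n + 1 : ℝ))⁻¹ ^ n = (1 + 1 / n : ℝ) ^ n := by rw [h]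
    _ ≤ Real.exp (1 / n) ^ n := by
        gcongr
        rw [add_comm]
        exact Real.add_one_le_exp _
    _ = Real.exp 1 := by rw [← Real.exp_nat_mul, mul_one_div_cancel hn'.ne']
    _ ≤ 3 := Real.exp_one_lt_three.le

theorem integral_norm_sum_dirichletKernel_le {d n : ℕ} (hd : 0 < d) (hn : 0 < n) :
    ∫ z in cube d, |∑ j ∈ Finset.range n, dirichletKernel d j z| ≤ fejerConst d * (n + 1) := by
  set r : ℝ := 1 - 1 / (n + 1 : ℝ) with hrdef
  have ha : 1 - r = 1 / (n + 1 : ℝ) := by rw [hrdef, sub_sub_cancel]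
  have ha0 : 0 < 1 - r := by
    rw [ha]
    positivity
  have hr1 : r < 1 := by linarith
  have hr : 1 / 2 ≤ r := by
    have h1 : (1 : ℝ) ≤ n := Nat.one_le_cast.2 hn
    have h2 : 1 / (n + 1 : ℝ) ≤ 1 / 2 := one_div_le_one_div_of_le two_pos (by linarith)
    linarith
  have hr0 : 0 < r := by linarith
  obtain ⟨K, hKn, hK⟩ : ∃ K, n ≤ K ∧ r ^ (K + 1) ≤ (1 - r) / 2 := by
    have h1 := (tendsto_pow_atTop_nhds_zero_of_lt_one hr0.le hr1).comp
      (Filter.tendsto_add_atTop_nat 1)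
    have h2 := h1.eventually (ge_mem_nhds (half_pos ha0))
    obtain ⟨K, h3, h4⟩ := ((Filter.eventually_ge_atTop n).and h2).exists
    exact ⟨K, h3, h4⟩
  have hd' : (1 : ℝ) ≤ d := Nat.one_le_cast.2 hd
  -- The remaining power `‖1-w‖^(p * d - 2)` must have exponent below `-1` for `circleMoment_le` to
  -- apply, so `p * d < 1` is needed; `1/2` is one choice.
  set p : ℝ := 1 / (2 * d) with hpdef
  have hp : 0 < p := by positivity
  have hp1 : p ≤ 1 := by
    rw [hpdef, div_le_one (by positivity)]
    linarith
  have hpd : p * d = 1 / 2 := by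
    rw [hpdef]
    field_simp
  set C : ℝ := 64 / p + 2 with hC
  have hC0 : 0 ≤ C := by positivity
  have hpt : ∀ t, ‖fejerWeight n r t‖ * (∫ x in (-1 : ℝ)..1, ‖poissonSum K (r * expi 1 t) x‖) ^ d
      ≤ 8 * C ^ d * (1 - r) ^ (-(1 / 2 : ℝ)) * ‖1 - r * expi 1 t‖ ^ (-(1 + 1 / 2 : ℝ)) := by
    intro t
    have hb : 0 < ‖1 - r * expi 1 t‖ :=
      norm_one_sub_pos ((norm_ofReal_mul_expi hr0.le 1 t).trans_lt hr1)
    have hI0 : 0 ≤ ∫ x in (-1 : ℝ)..1, ‖poissonSum K (r * expi 1 t) x‖ :=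
      intervalIntegral.integral_nonneg (by norm_num) fun _ _ => norm_nonneg _
    have hI := integral_norm_poissonSum_le (by linarith) hr1 hp hp1 hK t
    calc _ ≤ 8 / ‖1 - r * expi 1 t‖ ^ 2 * (C * (‖1 - r * expi 1 t‖ / (1 - r)) ^ p) ^ d := by
          gcongr
          exact norm_fejerWeight_le hr0 hr1 (inv_one_sub_inv_pow_le n) t
      _ = 8 / ‖1 - r * expi 1 t‖ ^ 2 * (C ^ d * (‖1 - r * expi 1 t‖ / (1 - r)) ^ (1 / 2 : ℝ)) := by
          rw [mul_pow, ← Real.rpow_mul_natCast (by positivity), hpd]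
      _ = _ := by
          rw [Real.div_rpow hb.le ha0.le, Real.rpow_neg ha0.le,
            show (-(1 + 1 / 2) : ℝ) = 1 / 2 - (2 : ℕ) by norm_num, Real.rpow_sub_natCast hb.ne']
          ring
  have hqc : Continuous fun t => ∫ x in (-1 : ℝ)..1, ‖poissonSum K (r * expi 1 t) x‖ :=
    intervalIntegral.continuous_parametric_intervalIntegral_of_continuous'
      (f := fun t x => ‖poissonSum K (r * expi 1 t) x‖)
      (continuous_poissonSum_uncurry K r).norm _ _
  calc _ ≤ _ := integral_norm_sum_dirichletKernel_le_integral hr0.ne' hKn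
    _ ≤ ∫ t in (-1 : ℝ)..1, 8 * C ^ d * (1 - r) ^ (-(1 / 2 : ℝ)) *
        ‖1 - r * expi 1 t‖ ^ (-(1 + 1 / 2 : ℝ)) := by
        refine intervalIntegral.integral_mono (by norm_num) ?_ ?_ hpt
        · exact ((continuous_fejerWeight n r).norm.mul (hqc.pow d)).intervalIntegrable _ _
        · exact (continuous_const.mul
            (continuous_norm_one_sub_rpow hr0.le hr1 _)).intervalIntegrable _ _
    _ = 8 * C ^ d * (1 - r) ^ (-(1 / 2 : ℝ)) * circleMoment r (1 / 2) := by
        rw [intervalIntegral.integral_const_mul, circleMoment]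
    _ ≤ 8 * C ^ d * (1 - r) ^ (-(1 / 2 : ℝ)) * (8 * ((1 - r) ^ (-(1 / 2 : ℝ)) / (1 / 2))) := by
        gcongr
        exact circleMoment_le (by linarith) hr1 (by norm_num) (by norm_num)
    _ = 128 * C ^ d * ((1 - r) ^ (-(1 / 2 : ℝ)) * (1 - r) ^ (-(1 / 2 : ℝ))) := by ring
    _ = fejerConst d * (n + 1) := by
        rw [← Real.rpow_add ha0, show (-(1 / 2) + -(1 / 2) : ℝ) = -1 by norm_num,
          Real.rpow_neg_one, ha, one_div, inv_inv, fejerConst]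

/-! ### The kernel as a normalized difference of sums of Dirichlet kernels. -/

theorem kernel_two_mul (d m : ℕ) (z : Fin d → ℝ) : kernel d (m + m) z
    = ((m : ℝ) + 1)⁻¹ * (∑ j ∈ Finset.range (m + m + 1), dirichletKernel d j z
      - ∑ j ∈ Finset.range m, dirichletKernel d j z) := by
  rw [kernel, show (m + m) / 2 = m by omega, ← Finset.sum_Ico_eq_sub _ (by omega)]
  rfl

theorem integral_norm_kernel_le {d N : ℕ} (hd : 0 < d) (hN0 : 0 < N) (hN : Even N) :
    ∫ z in cube d, ‖kernel d N z‖ ≤ 3 * fejerConst d := by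
  obtain ⟨m, rfl⟩ := hN
  have hm : 0 < m := by omega
  have hint : ∀ n : ℕ, IntegrableOn
      (fun z => |∑ j ∈ Finset.range n, dirichletKernel d j z|) (cube d) := fun n =>
    ((continuous_finsetSum _ fun j _ =>
      continuous_dirichletKernel d j).abs).continuousOn.integrableOn_compact (isCompact_cube d)
  have h1 := integral_norm_sum_dirichletKernel_le hd (Nat.succ_pos (m + m))
  have h2 := integral_norm_sum_dirichletKernel_le hd hm
  calc _ ≤ ∫ z in cube d, ((m : ℝ) + 1)⁻¹ *
        (|∑ j ∈ Finset.range (m + m + 1), dirichletKernel d j z|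
          + |∑ j ∈ Finset.range m, dirichletKernel d j z|) := by
        refine integral_mono ?_ (((hint _).add (hint _)).const_mul _) fun z => ?_
        · exact (continuous_kernel d _).norm.continuousOn.integrableOn_compact (isCompact_cube d)
        · change ‖kernel d (m + m) z‖ ≤ _
          rw [kernel_two_mul, Real.norm_eq_abs, abs_mul,
            abs_of_nonneg (by positivity : 0 ≤ ((m : ℝ) + 1)⁻¹)]
          gcongr
          exact abs_sub _ _
    _ = ((m : ℝ) + 1)⁻¹ *
        ((∫ z in cube d, |∑ j ∈ Finset.range (m + m + 1), dirichletKernel d j z|)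
          + ∫ z in cube d, |∑ j ∈ Finset.range m, dirichletKernel d j z|) := by
        rw [integral_const_mul, integral_add (hint _) (hint _)]
    -- The two sums have `2m + 1` and `m` terms, contributing `2m + 2` and `m + 1`, that is `3(m +
    -- 1)` in total.
    _ ≤ ((m : ℝ) + 1)⁻¹ * (fejerConst d * ((m + m + 1 : ℕ) + 1) + fejerConst d * (m + 1)) := by
        gcongr
    _ = 3 * fejerConst d := by
        push_cast
        field_simp
        ring

theorem eLpNorm_kernel_le {d N : ℕ} (hd : 0 < d) (hN0 : 0 < N) (hN : Even N) :
    eLpNorm (kernel d N) 1 (volume.restrict (cube d)) ≤ ENNReal.ofReal (3 * fejerConst d) := by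
  rw [eLpNorm_one_eq_lintegral_enorm, ← ofReal_integral_norm_eq_lintegral_enorm]
  · exact ENNReal.ofReal_le_ofReal (integral_norm_kernel_le hd hN0 hN)
  · exact (continuous_kernel d N).continuousOn.integrableOn_compact (isCompact_cube d)

end ValleePoussin

theorem mainTheorem6 (d : ℕ) (hd : 0 < d) :
    (∀ N : ℕ, 0 < N → Even N →
      (∀ f : (Fin d → ℝ) → ℝ, ValleePoussin.IsPeriodic f →
        IntegrableOn f (ValleePoussin.cube d) volume →
        ValleePoussin.circConv (ValleePoussin.kernel d N) f ∈ ValleePoussin.trigPoly d N) ∧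
      (∀ f ∈ ValleePoussin.trigPoly d (N / 2),
        ValleePoussin.circConv (ValleePoussin.kernel d N) f = f)) ∧
    ∃ Λ : NNReal, ∀ N : ℕ, 0 < N → Even N →
      eLpNorm (ValleePoussin.kernel d N) 1 (volume.restrict (ValleePoussin.cube d)) ≤ Λ :=
  ⟨fun _ _ hN => ⟨fun _ hf hint => ValleePoussin.circConv_kernel_mem_trigPoly hf hint,
    fun _ hf => ValleePoussin.circConv_kernel_eq_self hN hf⟩,
    (3 * ValleePoussin.fejerConst d).toNNReal,
    fun _ hN0 hN => ValleePoussin.eLpNorm_kernel_le hd hN0 hN⟩
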